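/- Theorem 1.1. All graphs are finite and simple, and $d_T(v)$ denotes the degree of $v$ in $T$. For a graph $G$, let $q(G)$ denote the largest eigenvalue of its signless Laplacian matrix $Q(G)=D(G)+A(G)$, where $D(G)$ is the diagonal matrix of vertex degrees and $A(G)$ is the adjacency matrix. Let $K_{a,b}$ be the complete bipartite graph with parts of sizes $a$ and $b$, the part of size $a$ being called its first part and the part of size $b$ its second part. For bipartite graphs $G_1$ with first part $A_1$ and second part $B_1$, and $G_2$ with first part $A_2$ and second part $B_2$, let $G_1\nabla G_2$ be the graph obtained from the disjoint union of $G_1$ and $G_2$ by adding all edges between $A_2$ and $B_1$. Let $k$, $m$ and $n$ be integers with $k\ge 3$, $m\ge 3$ and $n\ge (k-1)m+1$, and let $G$ be a connected bipartite graph with bipartition $A\cup B$, where $|A|=m$ and $|B|=n$. Suppose that $$q(G)\ \ge\ q\bigl(K_{1,k-1}\nabla K_{m-1,n-k+1}\bigr).$$ Then $G$ has a spanning tree $T$ with $d_T(v)\ge k$ for every $v\in A$, unless $G$ is isomorphic to $K_{1,k-1}\nabla K_{m-1,n-k+1}$, in which case $G$ has no such spanning tree. -/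

import Mathlib

/-- The signless Laplacian matrix `Q(G) = D(G) + A(G)` of a finite simple graph. -/
noncomputable def signlessLaplacian {V : Type*} [Fintype V] [DecidableEq V]
    (G : SimpleGraph V) [DecidableRel G.Adj] : Matrix V V ℝ :=
  G.degMatrix ℝ + G.adjMatrix ℝ

theorem signlessLaplacian_isHermitian {V : Type*} [Fintype V] [DecidableEq V]
    (G : SimpleGraph V) [DecidableRel G.Adj] : (signlessLaplacian G).IsHermitian :=
  (G.isHermitian_degMatrix ℝ).add (G.isHermitian_adjMatrix ℝ)

open Classical in
/-- The signless Laplacian spectral radius `q(G)`: the largest eigenvalue of `Q(G)`. -/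
noncomputable def signlessRadius {V : Type*} [Fintype V] (G : SimpleGraph V) : ℝ :=
  sSup {μ : ℝ | Module.End.HasEigenvalue (Matrix.toLin' (signlessLaplacian G)) μ}

open Classical in
/-- On a nonempty vertex set the supremum defining `q(G)` is attained. -/
theorem signlessRadius_isGreatest {V : Type*} [Fintype V] [Nonempty V] (G : SimpleGraph V) :
    IsGreatest {μ : ℝ | Module.End.HasEigenvalue (Matrix.toLin' (signlessLaplacian G)) μ}
      (signlessRadius G) := by
  have hs : {μ : ℝ | Module.End.HasEigenvalue (Matrix.toLin' (signlessLaplacian G)) μ} =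
      Set.range (signlessLaplacian_isHermitian G).eigenvalues := by
    rw [← Matrix.IsHermitian.spectrum_real_eq_range_eigenvalues, ← Matrix.spectrum_toLin']
    ext μ
    exact Module.End.hasEigenvalue_iff_mem_spectrum
  have hfin : (Set.range (signlessLaplacian_isHermitian G).eigenvalues).Finite :=
    Set.finite_range _
  unfold signlessRadius
  rw [hs]
  exact ⟨(Set.range_nonempty _).csSup_mem hfin, fun _ h => le_csSup hfin.bddAbove h⟩

/-- For bipartite graphs `G₁` with parts `A₁, B₁` and `G₂` with parts `A₂, B₂`, the graph `G₁ ∇ G₂`: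
the disjoint union of `G₁` and `G₂` together with all edges between `A₂` and `B₁`. The graphs are
given on `A₁ ⊕ B₁` and `A₂ ⊕ B₂`. -/
def bipartiteNabla {A₁ B₁ A₂ B₂ : Type*} (G₁ : SimpleGraph (A₁ ⊕ B₁))
    (G₂ : SimpleGraph (A₂ ⊕ B₂)) : SimpleGraph ((A₁ ⊕ B₁) ⊕ (A₂ ⊕ B₂)) :=
  SimpleGraph.sum G₁ G₂ ⊔
    SimpleGraph.fromRel fun x y =>
      (∃ a : A₂, x = Sum.inr (Sum.inl a)) ∧ ∃ b : B₁, y = Sum.inl (Sum.inr b)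

/-- The graph `K_{1,k-1} ∇ K_{m-1,n-k+1}`; it is only used when `1 ≤ k`, `1 ≤ m` and `k ≤ n`, so
that no subtraction is truncated. -/
def extremalGraph (k m n : ℕ) :
    SimpleGraph ((Fin 1 ⊕ Fin (k - 1)) ⊕ (Fin (m - 1) ⊕ Fin (n - k + 1))) :=
  bipartiteNabla (completeBipartiteGraph (Fin 1) (Fin (k - 1)))
    (completeBipartiteGraph (Fin (m - 1)) (Fin (n - k + 1)))

/-! By Lovász's theorem the tree exists as soon as `|N(S)| ≥ (k-1)|S| + 1` for every nonempty `S ⊆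
A` (`exists_isTree_le_of_hall`). A minimal family satisfying this condition has all sets of size
`k`; as a graph it is a forest, and a forest in a connected graph extends to a spanning tree.

If some `S` violates the condition, enlarge `N(S)` to `P ⊆ B` with `|P| = (k-1)|S|`. Connectedness
gives `N(A) = B`, so `|S| < m`. For `|S| ≥ 2`, a positive test vector gives `q(G) ≤ n + m - 1`
(`signlessRadius_le_of_neighbors_subset`), while the extremal graph exceeds this value since it
properly contains `K_{m-1,n}` (`lt_signlessRadius_extremalGraph`). For `|S| = 1`, `G` is a spanning
subgraph of the extremal graph, and strict monotonicity of `q` (`adj_of_signlessRadius_le`) makes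
the two isomorphic.

Conversely, the extremal graph has a vertex of degree `k - 1`, which must lie on the `A` side
because `m < n`. -/

section Spectral

/-! ### Rayleigh quotients and Perron–Frobenius theory for `Q(G)`. -/

open Matrix

variable {V W : Type*} [Fintype V] [Fintype W]

open Classical in
theorem signlessLaplacian_mulVec_apply (G : SimpleGraph V) (x : V → ℝ) (v : V) :
    (signlessLaplacian G *ᵥ x) v = ∑ u, if G.Adj v u then x v + x u else 0 := by
  rw [signlessLaplacian, Matrix.add_mulVec, Pi.add_apply, SimpleGraph.degMatrix_mulVec_apply,
    SimpleGraph.adjMatrix_mulVec_apply, ← Finset.sum_filter, Finset.sum_add_distrib,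
    Finset.sum_const, nsmul_eq_mul, ← SimpleGraph.neighborFinset_eq_filter,
    SimpleGraph.card_neighborFinset_eq_degree]

open Classical in
theorem dotProduct_signlessLaplacian_mulVec (G : SimpleGraph V) (x : V → ℝ) :
    x ⬝ᵥ (signlessLaplacian G *ᵥ x) =
      (∑ v, ∑ u, if G.Adj v u then (x v + x u) ^ 2 else 0) / 2 := by
  have h1 : x ⬝ᵥ (signlessLaplacian G *ᵥ x) =
      ∑ v, ∑ u, if G.Adj v u then x v * (x v + x u) else 0 := by
    simp only [dotProduct, signlessLaplacian_mulVec_apply, Finset.mul_sum, mul_ite, mul_zero]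
  have h2 : x ⬝ᵥ (signlessLaplacian G *ᵥ x) =
      ∑ v, ∑ u, if G.Adj v u then x u * (x v + x u) else 0 := by
    rw [h1, Finset.sum_comm]
    refine Finset.sum_congr rfl fun v _ => Finset.sum_congr rfl fun u _ => ?_
    simp only [G.adj_comm u v, add_comm (x u)]
  rw [eq_div_iff two_ne_zero, mul_two]
  nth_rewrite 1 [h1]
  rw [h2, ← Finset.sum_add_distrib]
  refine Finset.sum_congr rfl fun v _ => ?_
  rw [← Finset.sum_add_distrib]
  refine Finset.sum_congr rfl fun u _ => ?_
  split_ifs <;> ring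

open Classical in
theorem le_signlessRadius_of_mulVec_eq [Nonempty V] (G : SimpleGraph V) {c : ℝ} {x : V → ℝ}
    (hx : x ≠ 0) (h : signlessLaplacian G *ᵥ x = c • x) : c ≤ signlessRadius G :=
  (signlessRadius_isGreatest G).2
    (Module.End.hasEigenvalue_of_hasEigenvector
      (Module.End.hasEigenvector_iff.2 ⟨Module.End.mem_eigenspace_iff.2 (by simpa using h), hx⟩))

open Classical in
theorem exists_mulVec_eq_signlessRadius_smul [Nonempty V] (G : SimpleGraph V) :
    ∃ x : V → ℝ, x ≠ 0 ∧ signlessLaplacian G *ᵥ x = signlessRadius G • x := by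
  obtain ⟨x, hx⟩ := (signlessRadius_isGreatest G).1.exists_hasEigenvector
  exact ⟨x, hx.2, by simpa using hx.apply_eq_smul⟩

open Classical in
theorem posSemidef_signlessRadius_sub [Nonempty V] (G : SimpleGraph V) :
    (signlessRadius G • (1 : Matrix V V ℝ) - signlessLaplacian G).PosSemidef := by
  have hH : (signlessRadius G • (1 : Matrix V V ℝ) - signlessLaplacian G).IsHermitian := by
    refine IsHermitian.sub ?_ (signlessLaplacian_isHermitian G)
    rw [IsHermitian, conjTranspose_smul, conjTranspose_one, star_trivial]
  rw [hH.posSemidef_iff_eigenvalues_nonneg]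
  intro i
  have h := hH.mulVec_eigenvectorBasis i
  set x : V → ℝ := ⇑(hH.eigenvectorBasis i)
  have hx : x ≠ 0 := by
    intro h0
    have := hH.eigenvectorBasis.orthonormal.ne_zero i
    exact this (by ext v; exact congrFun h0 v)
  have h' : signlessLaplacian G *ᵥ x = (signlessRadius G - hH.eigenvalues i) • x := by
    rw [sub_smul, ← h, sub_mulVec, smul_mulVec, one_mulVec]
    abel
  have := le_signlessRadius_of_mulVec_eq G hx h'
  simp only [Pi.zero_apply]
  linarith

open Classical in
theorem dotProduct_signlessLaplacian_mulVec_le [Nonempty V] (G : SimpleGraph V) (x : V → ℝ) :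
    x ⬝ᵥ (signlessLaplacian G *ᵥ x) ≤ signlessRadius G * (x ⬝ᵥ x) := by
  have := (posSemidef_signlessRadius_sub G).dotProduct_mulVec_nonneg x
  rw [star_trivial, sub_mulVec, dotProduct_sub, smul_mulVec, one_mulVec, dotProduct_smul,
    smul_eq_mul] at this
  linarith

-- Since `q - Q` is positive semidefinite, a vector on which its quadratic form vanishes lies in its
-- kernel.
open Classical in
theorem mulVec_eq_of_dotProduct_eq [Nonempty V] (G : SimpleGraph V) {x : V → ℝ}
    (h : signlessRadius G * (x ⬝ᵥ x) ≤ x ⬝ᵥ (signlessLaplacian G *ᵥ x)) :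
    signlessLaplacian G *ᵥ x = signlessRadius G • x := by
  have := (posSemidef_signlessRadius_sub G).dotProduct_mulVec_zero_iff x
  rw [star_trivial, sub_mulVec, dotProduct_sub, smul_mulVec, one_mulVec, dotProduct_smul,
    smul_eq_mul, sub_eq_zero, sub_eq_zero] at this
  exact (this.1 (h.antisymm (dotProduct_signlessLaplacian_mulVec_le G x))).symm

open Classical in
/-- A positive vector `x` with `Q(G) x ≤ c x` bounds `q(G)` by `c`. -/
theorem signlessRadius_le_of_mulVec_le [Nonempty V] (G : SimpleGraph V) {c : ℝ} {x : V → ℝ}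
    (hx : ∀ v, 0 < x v) (h : ∀ v, (∑ u, if G.Adj v u then x v + x u else 0) ≤ c * x v) :
    signlessRadius G ≤ c := by
  obtain ⟨y, hy, hq⟩ := exists_mulVec_eq_signlessRadius_smul G
  -- Where `|y| / x` peaks, `|y| ≤ ρ x` is an equality, so the eigenvalue equation of `y` can be
  -- compared with the row bound for `x`.
  obtain ⟨v, hv⟩ := Finite.exists_max fun v => |y v| / x v
  set ρ := |y v| / x v with hρ
  have hle : ∀ u, |y u| ≤ ρ * x u := fun u => (div_le_iff₀ (hx u)).1 (hv u)
  have hyv : |y v| = ρ * x v := by rw [hρ, div_mul_cancel₀ _ (hx v).ne']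
  obtain ⟨w, hw⟩ := Function.ne_iff.1 hy
  have hρ0 : 0 < ρ := lt_of_lt_of_le (div_pos (abs_pos.2 hw) (hx w)) (hv w)
  have h1 : signlessRadius G * y v = ∑ u, if G.Adj v u then y v + y u else 0 := by
    rw [← signlessLaplacian_mulVec_apply, hq, Pi.smul_apply, smul_eq_mul]
  have h2 : signlessRadius G * |y v| ≤ ρ * (c * x v) := by
    calc signlessRadius G * |y v| ≤ |signlessRadius G * y v| := by
          rw [abs_mul]; gcongr; exact le_abs_self _
      _ ≤ ∑ u, |if G.Adj v u then y v + y u else 0| := by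
          rw [h1]; exact Finset.abs_sum_le_sum_abs _ _
      _ ≤ ∑ u, ρ * (if G.Adj v u then x v + x u else 0) := by
          refine Finset.sum_le_sum fun u _ => ?_
          split_ifs
          · linarith [abs_add_le (y v) (y u), hle v, hle u]
          · simp
      _ ≤ ρ * (c * x v) := by rw [← Finset.mul_sum]; gcongr; exact h v
  rw [hyv] at h2
  have : 0 < ρ * x v := mul_pos hρ0 (hx v)
  nlinarith

open Classical in
/-- Perron–Frobenius for the signless Laplacian of a connected graph. -/
theorem exists_pos_mulVec_eq_signlessRadius_smul (G : SimpleGraph V) (hG : G.Connected) :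
    ∃ x : V → ℝ, (∀ v, 0 < x v) ∧ signlessLaplacian G *ᵥ x = signlessRadius G • x := by
  have := hG.nonempty
  obtain ⟨y, hy, hq⟩ := exists_mulVec_eq_signlessRadius_smul G
  -- Taking absolute values keeps the norm and does not lower the form, so `z` still attains the
  -- maximum.
  set z : V → ℝ := fun v => |y v| with hz
  have hzz : z ⬝ᵥ z = y ⬝ᵥ y := by simp [dotProduct, hz]
  have hz' : signlessLaplacian G *ᵥ z = signlessRadius G • z := by
    apply mulVec_eq_of_dotProduct_eq
    have : signlessRadius G * (y ⬝ᵥ y) = y ⬝ᵥ (signlessLaplacian G *ᵥ y) := by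
      rw [hq, dotProduct_smul, smul_eq_mul]
    rw [hzz, this, dotProduct_signlessLaplacian_mulVec, dotProduct_signlessLaplacian_mulVec]
    gcongr with v _ u _
    split_ifs
    · rw [← sq_abs (y v + y u)]
      exact pow_le_pow_left₀ (abs_nonneg _) (abs_add_le _ _) 2
    · rfl
  have hstep : ∀ v u, G.Adj v u → z v = 0 → z u = 0 := by
    intro v u huv hv
    have h1 : (0 : ℝ) = ∑ w, if G.Adj v w then z v + z w else 0 := by
      rw [← signlessLaplacian_mulVec_apply, hz', Pi.smul_apply, hv, smul_zero]
    have h2 := (Finset.sum_eq_zero_iff_of_nonneg (fun w _ => by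
      split_ifs
      · exact add_nonneg (abs_nonneg _) (abs_nonneg _)
      · rfl)).1 h1.symm u (Finset.mem_univ u)
    rwa [if_pos huv, hv, zero_add] at h2
  refine ⟨z, fun v => lt_of_le_of_ne (abs_nonneg _) fun h0 => hy ?_, hz'⟩
  funext u
  obtain ⟨p⟩ := hG.preconnected v u
  have : z u = 0 := by
    clear hy
    induction p with
    | nil => exact h0.symm
    | cons hadj _ ih => exact ih (hstep _ _ hadj h0.symm).symm
  exact abs_eq_zero.1 this

/-- A bijective homomorphism from a connected graph that does not raise `q` reflects adjacency. -/
theorem adj_of_signlessRadius_le {G : SimpleGraph V} {H : SimpleGraph W} (hG : G.Connected)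
    (e : V ≃ W) (he : ∀ u v, G.Adj u v → H.Adj (e u) (e v))
    (hq : signlessRadius H ≤ signlessRadius G) {u v : V} (huv : H.Adj (e u) (e v)) :
    G.Adj u v := by
  classical
  by_contra hn
  have := hG.nonempty
  have : Nonempty W := ⟨e u⟩
  obtain ⟨x, hx, hQ⟩ := exists_pos_mulVec_eq_signlessRadius_smul G hG
  have h1 := dotProduct_signlessLaplacian_mulVec_le H (x ∘ e.symm)
  have h2 : signlessRadius G * (x ⬝ᵥ x) = x ⬝ᵥ (signlessLaplacian G *ᵥ x) := by
    rw [hQ, dotProduct_smul, smul_eq_mul]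
  have h3 : (x ∘ e.symm) ⬝ᵥ (x ∘ e.symm) = x ⬝ᵥ x := by
    simp only [dotProduct, Function.comp_apply]
    exact e.symm.sum_comp fun v => x v * x v
  have hle : ∀ a b, (if G.Adj a b then (x a + x b) ^ 2 else 0) ≤
      (if H.Adj (e a) (e b) then (x a + x b) ^ 2 else 0) := by
    intro a b
    by_cases hab : G.Adj a b
    · rw [if_pos hab, if_pos (he a b hab)]
    · rw [if_neg hab]; split_ifs <;> positivity
  -- The extra edge adds `(x u + x v) ^ 2 > 0` to the form of the transported Perron vector.
  have h4 : x ⬝ᵥ (signlessLaplacian G *ᵥ x) <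
      (x ∘ e.symm) ⬝ᵥ (signlessLaplacian H *ᵥ (x ∘ e.symm)) := by
    rw [dotProduct_signlessLaplacian_mulVec, dotProduct_signlessLaplacian_mulVec,
      ← e.sum_comp]
    simp only [← e.sum_comp (fun w => ite (H.Adj _ w) _ _), Function.comp_apply,
      Equiv.symm_apply_apply]
    refine div_lt_div_of_pos_right ?_ two_pos
    refine Finset.sum_lt_sum (fun a _ => Finset.sum_le_sum fun b _ => hle a b)
      ⟨u, Finset.mem_univ u, Finset.sum_lt_sum (fun b _ => hle u b) ⟨v, Finset.mem_univ v, ?_⟩⟩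
    rw [if_neg hn, if_pos huv]
    have := hx u; have := hx v; positivity
  have h5 : 0 ≤ x ⬝ᵥ x := Finset.sum_nonneg fun v _ => mul_self_nonneg (x v)
  rw [h3] at h1
  nlinarith [mul_le_mul_of_nonneg_right hq h5]

end Spectral

/-! ### Lower bound for the extremal graph. -/

/-- The test vector is the Perron vector of `K_{m-1,n}`, with eigenvalue `n + m - 1`, extended by
zero; the `k - 1` edges at the remaining vertex make the inequality strict. -/
theorem lt_signlessRadius_extremalGraph {k m n : ℕ} (hk : 2 ≤ k) (hm : 2 ≤ m) (hn : k ≤ n) :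
    (n + m - 1 : ℝ) < signlessRadius (extremalGraph k m n) := by
  classical
  set x : (Fin 1 ⊕ Fin (k - 1)) ⊕ (Fin (m - 1) ⊕ Fin (n - k + 1)) → ℝ :=
    Sum.elim (Sum.elim (fun _ => 0) fun _ => m - 1) (Sum.elim (fun _ => n) fun _ => m - 1) with hx
  have h1 := dotProduct_signlessLaplacian_mulVec_le (extremalGraph k m n) x
  rw [dotProduct_signlessLaplacian_mulVec] at h1
  generalize signlessRadius (extremalGraph k m n) = q at h1 ⊢
  have hk' : ((k - 1 : ℕ) : ℝ) = k - 1 := by push_cast [show 1 ≤ k by omega]; ring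
  have hm' : ((m - 1 : ℕ) : ℝ) = m - 1 := by push_cast [show 1 ≤ m by omega]; ring
  have hn' : ((n - k : ℕ) : ℝ) = n - k := by push_cast [hn]; ring
  have hk2 : (2 : ℝ) ≤ k := by exact_mod_cast hk
  have hm2 : (2 : ℝ) ≤ m := by exact_mod_cast hm
  have hkn : (k : ℝ) ≤ n := by exact_mod_cast hn
  simp [dotProduct, extremalGraph, bipartiteNabla, hx, Fintype.sum_sum_type, hk', hm', hn'] at h1
  by_contra! hcon
  have h2 : (0 : ℝ) < (k - 1) * (m - 1) ^ 2 :=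
    mul_pos (by linarith) (pow_pos (by linarith) 2)
  have h3 : (0 : ℝ) ≤ n * (m - 1) * (n + m - 1) :=
    mul_nonneg (mul_nonneg (by linarith) (by linarith)) (by linarith)
  nlinarith [mul_le_mul_of_nonneg_right hcon h3]

/-! ### Lovász's spanning tree theorem. -/

open Finset in
/-- A family satisfying the strong Hall condition contains one with all sets of size `k + 1`. -/
theorem exists_card_eq_of_hall {ι α : Type*} [Finite ι] [DecidableEq ι] [DecidableEq α]
    {k : ℕ} {A : Finset ι} {t : ι → Finset α}
    (h : ∀ s ⊆ A, s.Nonempty → k * #s + 1 ≤ #(s.biUnion t)) :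
    ∃ t' ≤ t, (∀ i ∈ A, #(t' i) = k + 1) ∧
      ∀ s ⊆ A, s.Nonempty → k * #s + 1 ≤ #(s.biUnion t') := by
  obtain ⟨t', ht', hmin⟩ := exists_minimal_le_of_wellFoundedLT
    (fun t : ι → Finset α => ∀ s ⊆ A, s.Nonempty → k * #s + 1 ≤ #(s.biUnion t)) t h
  refine ⟨t', ht', fun i hi => ?_, hmin.prop⟩
  have hge : k + 1 ≤ #(t' i) := by simpa using hmin.prop {i} (by simpa using hi) (by simp)
  -- By minimality, deleting `b` from `t' i` breaks the condition at some `s`; that `s` is tight and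
  -- only `i` covers `b` in it.
  have hcrit : ∀ b ∈ t' i, ∃ s ⊆ A, i ∈ s ∧ #(s.biUnion t') ≤ k * #s + 1 ∧
      b ∉ (s.erase i).biUnion t' := by
    intro b hb
    set u := Function.update t' i ((t' i).erase b) with hu
    have hui : u i = (t' i).erase b := by simp [hu]
    have huj : ∀ j, j ≠ i → u j = t' j := fun j hj => by simp [hu, hj]
    have hlt : ¬ t' ≤ u := fun hle => by
      have := hle i hb
      simp [hui] at this
    have hule : u ≤ t' := by
      intro j
      by_cases hj : j = i
      · subst hj; rw [hui]; exact erase_subset _ _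
      · rw [huj j hj]
    have hnot : ¬ ∀ s ⊆ A, s.Nonempty → k * #s + 1 ≤ #(s.biUnion u) :=
      fun hall => hlt (hmin.le_of_le hall hule)
    push Not at hnot
    obtain ⟨s, hsA, hs, hcard⟩ := hnot
    have hold := hmin.prop s hsA hs
    have hbne : b ∉ (s.erase i).biUnion t' := by
      intro hb'
      have : s.biUnion t' ⊆ s.biUnion u := by
        intro a ha
        obtain ⟨j, hj, haj⟩ := mem_biUnion.1 ha
        by_cases hab : a = b
        · subst hab
          obtain ⟨l, hl, hal⟩ := mem_biUnion.1 hb'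
          rw [mem_erase] at hl
          exact mem_biUnion.2 ⟨l, hl.2, by rwa [huj l hl.1]⟩
        · refine mem_biUnion.2 ⟨j, hj, ?_⟩
          by_cases hji : j = i
          · subst hji; rw [hui]; exact mem_erase.2 ⟨hab, haj⟩
          · rwa [huj j hji]
      have := card_le_card this
      omega
    have his : i ∈ s := by
      by_contra his
      have : s.biUnion u = s.biUnion t' :=
        biUnion_congr rfl fun j hj => huj j fun hji => his (hji ▸ hj)
      rw [this] at hcard
      omega
    refine ⟨s, hsA, his, ?_, hbne⟩
    have hsub : s.biUnion t' ⊆ insert b (s.biUnion u) := by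
      intro a ha
      obtain ⟨j, hj, haj⟩ := mem_biUnion.1 ha
      by_cases hab : a = b
      · simp [hab]
      · refine mem_insert_of_mem (mem_biUnion.2 ⟨j, hj, ?_⟩)
        by_cases hji : j = i
        · subst hji; rw [hui]; exact mem_erase.2 ⟨hab, haj⟩
        · rwa [huj j hji]
    have := (card_le_card hsub).trans (card_insert_le _ _)
    omega
  -- Tight sets containing `i` are closed under intersection, by submodularity of `s ↦ #(s.biUnion
  -- t')`; hence one tight set serves all of `t' i`.
  have hall : ∀ C ⊆ t' i, ∃ s ⊆ A, i ∈ s ∧ #(s.biUnion t') ≤ k * #s + 1 ∧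
      ∀ b ∈ C, b ∉ (s.erase i).biUnion t' := by
    intro C
    induction C using Finset.induction_on with
    | empty =>
      intro _
      obtain ⟨b, hb⟩ := card_pos.1 (show 0 < #(t' i) by omega)
      obtain ⟨s, h1, h2, h3, -⟩ := hcrit b hb
      exact ⟨s, h1, h2, h3, by simp⟩
    | insert b C _ ih =>
      intro hC
      obtain ⟨s, hsA, his, hs, hsC⟩ := ih ((subset_insert _ _).trans hC)
      obtain ⟨s', hsA', his', hs', hsb⟩ := hcrit b (hC (mem_insert_self _ _))
      have hi' : i ∈ s ∩ s' := mem_inter.2 ⟨his, his'⟩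
      refine ⟨s ∩ s', inter_subset_left.trans hsA, hi', ?_, ?_⟩
      · have h1 := hmin.prop (s ∪ s') (union_subset hsA hsA') ⟨i, mem_union_left _ his⟩
        have h2 : (s ∩ s').biUnion t' ⊆ s.biUnion t' ∩ s'.biUnion t' :=
          subset_inter (biUnion_subset_biUnion_of_subset_left _ inter_subset_left)
            (biUnion_subset_biUnion_of_subset_left _ inter_subset_right)
        have h3 := card_le_card h2
        have h4 := card_union_add_card_inter (s.biUnion t') (s'.biUnion t')
        rw [← union_biUnion] at h4
        have h5 := congrArg (k * ·) (card_union_add_card_inter s s')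
        simp only [mul_add] at h5
        omega
      · intro c hc hcs
        have hl : c ∈ (s.erase i).biUnion t' := biUnion_subset_biUnion_of_subset_left _
          (erase_subset_erase _ inter_subset_left) hcs
        have hr : c ∈ (s'.erase i).biUnion t' := biUnion_subset_biUnion_of_subset_left _
          (erase_subset_erase _ inter_subset_right) hcs
        rcases mem_insert.1 hc with rfl | hc
        · exact hsb hr
        · exact hsC c hc hl
  obtain ⟨s, hsA, his, hs, hsC⟩ := hall (t' i) subset_rfl
  have hcard : #(s.biUnion t') = #(t' i) + #((s.erase i).biUnion t') := by
    rw [← card_union_of_disjoint (disjoint_left.2 hsC), ← biUnion_insert, insert_erase his]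
  have hes := card_erase_add_one his
  -- If `s` had other members, the condition on them would leave at most `k` elements for `t' i`; so
  -- `s = {i}`, and tightness gives size `k + 1`.
  rcases (s.erase i).eq_empty_or_nonempty with he | he
  · rw [he] at hcard hes
    simp at hcard hes
    rw [← hes] at hs
    omega
  · have := hmin.prop _ ((erase_subset _ _).trans hsA) he
    rw [← hes, mul_add] at hs
    omega

open Finset in
/-- A bipartite graph with all degrees `k + 1` on one side and the strong Hall condition there is a
forest. -/
theorem isAcyclic_of_hall {V : Type*} [Fintype V] [DecidableEq V] {F : SimpleGraph V}
    [DecidableRel F.Adj] {A B : Finset V} (hF : F.IsBipartiteWith (A : Set V) (B : Set V)) {k : ℕ}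
    (hk : 1 ≤ k) (hdeg : ∀ v ∈ A, F.degree v = k + 1)
    (hall : ∀ s ⊆ A, s.Nonempty → k * #s + 1 ≤ #(s.biUnion fun v => F.neighborFinset v)) :
    F.IsAcyclic := by
  classical
  intro w c hc
  set C := c.toSubgraph.spanningCoe with hC
  have hCF : C ≤ F := c.toSubgraph.spanningCoe_le
  have hCb : C.IsBipartiteWith (A : Set V) (B : Set V) :=
    ⟨hF.disjoint, fun _ _ h => hF.mem_of_adj (hCF h)⟩
  have hd2 : ∀ v ∈ c.support, C.degree v = 2 := by
    intro v hv
    rw [← hc.ncard_neighborSet_toSubgraph_eq_two hv, ← SimpleGraph.card_neighborSet_eq_degree,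
      ← Nat.card_eq_fintype_card]
    rfl
  have hd0 : ∀ v ∉ c.support, C.degree v = 0 := by
    intro v hv
    rw [← SimpleGraph.card_neighborFinset_eq_degree, card_eq_zero, eq_empty_iff_forall_notMem]
    intro u hu
    rw [SimpleGraph.mem_neighborFinset] at hu
    exact hv ((SimpleGraph.Walk.mem_verts_toSubgraph c).1 (c.toSubgraph.edge_vert hu))
  have hsum : ∀ X : Finset V, ∑ v ∈ X, C.degree v = 2 * #(X.filter (· ∈ c.support)) := by
    intro X
    rw [card_filter, mul_sum]
    refine sum_congr rfl fun v _ => ?_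
    split_ifs with hv
    · rw [hd2 v hv, mul_one]
    · rw [hd0 v hv, mul_zero]
  have heq := SimpleGraph.isBipartiteWith_sum_degrees_eq hCb
  rw [hsum, hsum] at heq
  set S := A.filter (· ∈ c.support)
  set R := B.filter (· ∈ c.support) with hR
  have hne : S.Nonempty := by
    by_contra hS
    rw [not_nonempty_iff_eq_empty] at hS
    rw [hS, card_empty] at heq
    have hR0 : R = ∅ := by rw [← card_eq_zero]; omega
    have hw := c.start_mem_support
    have hpos : 0 < C.degree w := by rw [hd2 w hw]; norm_num
    obtain ⟨u, hu⟩ := (C.degree_pos_iff_exists_adj w).1 hpos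
    rcases hCb.mem_of_adj hu with ⟨h, -⟩ | ⟨h, -⟩
    · exact notMem_empty w (hS ▸ mem_filter.2 ⟨h, hw⟩)
    · exact notMem_empty w (hR0 ▸ mem_filter.2 ⟨h, hw⟩)
  have hN := hall S (filter_subset _ _) hne
  have hsub : (S.biUnion fun v => F.neighborFinset v) ⊆
      R ∪ S.biUnion fun v => F.neighborFinset v \ C.neighborFinset v := by
    intro b hb
    obtain ⟨v, hv, hvb⟩ := mem_biUnion.1 hb
    by_cases h : C.Adj v b
    · refine mem_union_left _ (mem_filter.2 ⟨?_, ?_⟩)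
      · exact hCb.mem_of_mem_adj (mem_filter.1 hv).1 h
      · exact (SimpleGraph.Walk.mem_verts_toSubgraph c).1 (c.toSubgraph.edge_vert h.symm)
    · refine mem_union_right _ (mem_biUnion.2 ⟨v, hv, mem_sdiff.2 ⟨hvb, ?_⟩⟩)
      simpa using h
  -- Two of the `k + 1` neighbours lie on the cycle, and `#R = #S`, so `S` has at most `k * #S`
  -- neighbours.
  have h1 : #(S.biUnion fun v => F.neighborFinset v \ C.neighborFinset v) ≤ #S * (k - 1) := by
    refine card_biUnion_le_card_mul _ _ _ fun v hv => ?_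
    rw [card_sdiff_of_subset (fun u hu => by simpa using hCF (by simpa using hu)),
      SimpleGraph.card_neighborFinset_eq_degree, SimpleGraph.card_neighborFinset_eq_degree,
      hdeg v (mem_filter.1 hv).1, hd2 v (mem_filter.1 hv).2]
    omega
  have h2 := (card_le_card hsub).trans (card_union_le _ _)
  obtain ⟨l, rfl⟩ : ∃ l, k = l + 1 := ⟨k - 1, by omega⟩
  simp only [Nat.add_sub_cancel] at h1
  nlinarith

open Finset in
/-- Lovász's spanning tree theorem for uniform degree bounds. -/
theorem exists_isTree_le_of_hall {V : Type*} [Fintype V] [DecidableEq V] {G : SimpleGraph V}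
    [DecidableRel G.Adj] (hG : G.Connected) {A B : Finset V}
    (hAB : G.IsBipartiteWith (A : Set V) (B : Set V)) {k : ℕ} (hk : 1 ≤ k)
    (hall : ∀ s ⊆ A, s.Nonempty → k * #s + 1 ≤ #(s.biUnion fun v => G.neighborFinset v)) :
    ∃ T ≤ G, T.IsTree ∧ ∀ v ∈ A, k + 1 ≤ (T.neighborSet v).ncard := by
  classical
  obtain ⟨t, ht, hcard, hall'⟩ := exists_card_eq_of_hall hall
  have htG : ∀ v u, u ∈ t v → G.Adj v u := fun v u hu => by simpa using ht v hu
  let F : SimpleGraph V :=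
    { Adj := fun u v => (u ∈ A ∧ v ∈ t u) ∨ (v ∈ A ∧ u ∈ t v)
      symm := ⟨fun u v h => h.symm⟩
      loopless := ⟨fun v h => by rcases h with h | h <;> exact G.irrefl (htG v v h.2)⟩ }
  have hFG : F ≤ G := by
    rintro u v (h | h)
    · exact htG _ _ h.2
    · exact (htG _ _ h.2).symm
  have hFb : F.IsBipartiteWith (A : Set V) (B : Set V) :=
    ⟨hAB.disjoint, fun _ _ h => hAB.mem_of_adj (hFG h)⟩
  have hN : ∀ v ∈ A, F.neighborFinset v = t v := by
    intro v hv
    ext u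
    rw [SimpleGraph.mem_neighborFinset]
    refine ⟨?_, fun h => Or.inl ⟨hv, h⟩⟩
    rintro (h | h)
    · exact h.2
    · have huB := hAB.mem_of_mem_adj hv (htG _ _ h.2).symm
      exact absurd huB (Set.disjoint_left.1 hAB.disjoint h.1)
  have hF : F.IsAcyclic := by
    refine isAcyclic_of_hall hFb hk (fun v hv => ?_) fun s hs hne => ?_
    · rw [← SimpleGraph.card_neighborFinset_eq_degree, hN v hv, hcard v hv]
    · rw [biUnion_congr rfl fun v hv => hN v (hs hv)]
      exact hall' s hs hne
  obtain ⟨T, hFT, hTG, hT⟩ := hG.exists_isTree_le_of_le_of_isAcyclic hFG hF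
  refine ⟨T, hTG, hT, fun v hv => ?_⟩
  rw [← hcard v hv, ← hN v hv, ← Set.ncard_coe_finset]
  refine Set.ncard_le_ncard (fun u hu => hFT ?_) (Set.toFinite _)
  simpa using hu

/-! ### Upper bound for a violating set of at least two vertices. -/

open Finset in
/-- If two or more vertices of `A`, but not all, have few neighbours, then `q(G) ≤ |A| + |B| - 1`. -/
theorem signlessRadius_le_of_neighbors_subset {V : Type*} [Fintype V] [DecidableEq V]
    {G : SimpleGraph V} {A B S P : Finset V}
    (hAB : G.IsBipartiteWith (A : Set V) (B : Set V)) (hV : ∀ v, v ∈ A ∨ v ∈ B)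
    (hSA : S ⊆ A) (hPB : P ⊆ B) (hN : ∀ v ∈ S, ∀ u, G.Adj v u → u ∈ P) {k : ℕ} (hk : 2 ≤ k)
    (hs : 2 ≤ #S) (hsm : #S < #A) (hP : #P = k * #S) (hn : k * #A + 1 ≤ #B) :
    signlessRadius G ≤ #B + #A - 1 := by
  classical
  have hdisj : Disjoint A B := by exact_mod_cast hAB.disjoint
  have hne : Nonempty V := ⟨(card_pos.1 (show 0 < #S by omega)).choose⟩
  obtain ⟨s, hs'⟩ : ∃ s : ℝ, s = #S := ⟨_, rfl⟩
  obtain ⟨t, ht'⟩ : ∃ t : ℝ, t = #(A \ S) := ⟨_, rfl⟩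
  obtain ⟨p, hp'⟩ : ∃ p : ℝ, p = #P := ⟨_, rfl⟩
  obtain ⟨r, hr'⟩ : ∃ r : ℝ, r = #(B \ P) := ⟨_, rfl⟩
  have hAc : (#A : ℝ) = s + t := by
    rw [hs', ht', add_comm]; exact_mod_cast (card_sdiff_add_card_eq_card hSA).symm
  have hBc : (#B : ℝ) = p + r := by
    rw [hp', hr', add_comm]; exact_mod_cast (card_sdiff_add_card_eq_card hPB).symm
  have hs2 : 2 ≤ s := by rw [hs']; exact_mod_cast hs
  have ht1 : 1 ≤ t := by
    have : (#S : ℝ) + 1 ≤ #A := by exact_mod_cast hsm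
    linarith
  have hk2 : (2 : ℝ) ≤ k := by exact_mod_cast hk
  have hpk : p = k * s := by rw [hp', hs']; exact_mod_cast hP
  have hrk : 2 * t + 1 ≤ r := by
    have : (k * #A + 1 : ℝ) ≤ #B := by exact_mod_cast hn
    rw [hAc, hBc, hpk] at this
    nlinarith
  have hp0 : 0 < p := by rw [hpk]; positivity
  have hD : 0 < r + (s + t) - 1 := by linarith
  -- This `a` makes the row inequality on `S` an equality; the weight `t` on `B \ P` does the same
  -- there.
  obtain ⟨a, ha⟩ : ∃ a, a = p * (s + t - 1) / (r + (s + t) - 1) := ⟨_, rfl⟩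
  have haD : a * (r + (s + t) - 1) = p * (s + t - 1) := by rw [ha, div_mul_cancel₀ _ hD.ne']
  have ha0 : 0 < a := by rw [ha]; exact div_pos (mul_pos hp0 (by linarith)) hD
  have hsa : s * a ≤ (s - 1) * p := by
    rw [ha, ← mul_div_assoc, div_le_iff₀ hD]
    have : s * (s + t - 1) ≤ (s - 1) * (r + (s + t) - 1) := by nlinarith
    nlinarith [mul_le_mul_of_nonneg_left this hp0.le]
  rw [hAc, hBc]
  set x : V → ℝ := fun v =>
    if v ∈ S then a else if v ∈ P then s + t - 1 else if v ∈ A then p + r + s - 1 else t with hx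
  have hxS : ∀ v ∈ S, x v = a := fun v hv => by simp [hx, hv]
  have hxP : ∀ v ∈ P, x v = s + t - 1 := fun v hv => by
    have hvS : v ∉ S := fun h => disjoint_left.1 hdisj (hSA h) (hPB hv)
    simp [hx, hv, hvS]
  have hxA : ∀ v ∈ A \ S, x v = p + r + s - 1 := fun v hv => by
    rw [mem_sdiff] at hv
    have hvP : v ∉ P := fun h => disjoint_left.1 hdisj hv.1 (hPB h)
    simp [hx, hv, hvP]
  have hxB : ∀ v ∈ B \ P, x v = t := fun v hv => by
    rw [mem_sdiff] at hv
    have hvA : v ∉ A := fun h => disjoint_left.1 hdisj h hv.1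
    have hvS : v ∉ S := fun h => hvA (hSA h)
    simp [hx, hv, hvA, hvS]
  have hpos : ∀ v, 0 < x v := by
    intro v
    simp only [hx]
    split_ifs <;> linarith
  have hsum : ∀ v, ∀ X : Finset V, (∀ u, G.Adj v u → u ∈ X) →
      (∑ u, if G.Adj v u then x v + x u else 0) ≤ ∑ u ∈ X, (x v + x u) := by
    intro v X hX
    rw [← sum_filter]
    refine sum_le_sum_of_subset_of_nonneg (fun u hu => hX u (mem_filter.1 hu).2) fun u _ _ => ?_
    exact (add_pos (hpos v) (hpos u)).le
  have hconst : ∀ (X : Finset V) (y z : ℝ), (∀ u ∈ X, x u = z) →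
      ∑ u ∈ X, (y + x u) = #X * (y + z) := by
    intro X y z h
    rw [sum_congr rfl fun u hu => by rw [h u hu], sum_const, nsmul_eq_mul]
  refine signlessRadius_le_of_mulVec_le G hpos fun v => ?_
  by_cases hvS : v ∈ S
  · refine (hsum v P (hN v hvS)).trans ?_
    rw [hconst _ _ _ hxP, hxS v hvS, ← hp']
    linarith
  by_cases hvP : v ∈ P
  · refine (hsum v A fun u hu => hAB.symm.mem_of_mem_adj (hPB hvP) hu).trans ?_
    rw [← sum_sdiff hSA, hconst _ _ _ hxA, hconst _ _ _ hxS, hxP v hvP, ← hs', ← ht']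
    nlinarith
  by_cases hvA : v ∈ A
  · refine (hsum v B fun u hu => hAB.mem_of_mem_adj hvA hu).trans ?_
    rw [← sum_sdiff hPB, hconst _ _ _ hxB, hconst _ _ _ hxP, hxA v (mem_sdiff.2 ⟨hvA, hvS⟩),
      ← hp', ← hr']
    have : 0 ≤ (s - 1) * (r + (s + t - 1)) := mul_nonneg (by linarith) (by linarith)
    nlinarith
  · have hvB : v ∈ B := (hV v).resolve_left hvA
    have hu : ∀ u, G.Adj v u → u ∈ A \ S := by
      intro u hu
      exact mem_sdiff.2 ⟨hAB.symm.mem_of_mem_adj hvB hu, fun huS => hvP (hN u huS v hu.symm)⟩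
    refine (hsum v _ hu).trans ?_
    rw [hconst _ _ _ hxA, hxB v (mem_sdiff.2 ⟨hvB, hvP⟩), ← ht']
    nlinarith

/-! ### Comparison with the extremal graph. -/

open Finset in
/-- A bipartite graph in which a vertex of `A` has all its neighbours in a set of `k - 1` vertices
is, up to isomorphism, a spanning subgraph of the extremal graph. -/
theorem exists_equiv_extremalGraph {V : Type*} [Fintype V] [DecidableEq V]
    {G : SimpleGraph V} {A B P : Finset V} {w : V}
    (hAB : G.IsBipartiteWith (A : Set V) (B : Set V)) (hV : ∀ v, v ∈ A ∨ v ∈ B)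
    (hw : w ∈ A) (hPB : P ⊆ B) (hN : ∀ u, G.Adj w u → u ∈ P) {k m n : ℕ} (hk : 1 ≤ k)
    (hkn : k ≤ n) (hA : #A = m) (hB : #B = n) (hP : #P = k - 1) :
    ∃ e : V ≃ (Fin 1 ⊕ Fin (k - 1)) ⊕ (Fin (m - 1) ⊕ Fin (n - k + 1)),
      ∀ u v, G.Adj u v → (extremalGraph k m n).Adj (e u) (e v) := by
  have hdisj : Disjoint A B := by exact_mod_cast hAB.disjoint
  have hA' : #(A.erase w) = m - 1 := by rw [card_erase_of_mem hw, hA]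
  have hB' : #(B \ P) = n - k + 1 := by rw [card_sdiff_of_subset hPB, hB, hP]; omega
  let eP := P.equivFinOfCardEq hP
  let eA := (A.erase w).equivFinOfCardEq hA'
  let eB := (B \ P).equivFinOfCardEq hB'
  let g : (Fin 1 ⊕ Fin (k - 1)) ⊕ (Fin (m - 1) ⊕ Fin (n - k + 1)) → V :=
    Sum.elim (Sum.elim (fun _ => w) fun i => (eP.symm i).1)
      (Sum.elim (fun i => (eA.symm i).1) fun i => (eB.symm i).1)
  have hsurj : Function.Surjective g := by
    intro v
    by_cases hvw : v = w
    · exact ⟨Sum.inl (Sum.inl 0), hvw.symm⟩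
    by_cases hvP : v ∈ P
    · exact ⟨Sum.inl (Sum.inr (eP ⟨v, hvP⟩)), by simp [g]⟩
    rcases hV v with hv | hv
    · exact ⟨Sum.inr (Sum.inl (eA ⟨v, mem_erase.2 ⟨hvw, hv⟩⟩)), by simp [g]⟩
    · exact ⟨Sum.inr (Sum.inr (eB ⟨v, mem_sdiff.2 ⟨hv, hvP⟩⟩)), by simp [g]⟩
  have hcard : Fintype.card ((Fin 1 ⊕ Fin (k - 1)) ⊕ (Fin (m - 1) ⊕ Fin (n - k + 1))) =
      Fintype.card V := by
    have h1 : (univ : Finset V) = A ∪ B := by ext v; simpa using hV v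
    have h2 : 0 < #A := card_pos.2 ⟨w, hw⟩
    rw [← card_univ (α := V), h1, card_union_of_disjoint hdisj, hA, hB]
    simp only [Fintype.card_sum, Fintype.card_fin]
    omega
  let e := Equiv.ofBijective g ((Fintype.bijective_iff_surjective_and_card g).2 ⟨hsurj, hcard⟩)
  have hAA : ∀ u ∈ A, ∀ v ∈ A, ¬ G.Adj u v := fun u hu v hv h =>
    disjoint_left.1 hdisj hv (hAB.mem_of_mem_adj hu h)
  have hBB : ∀ u ∈ B, ∀ v ∈ B, ¬ G.Adj u v := fun u hu v hv h =>
    disjoint_left.1 hdisj (hAB.symm.mem_of_mem_adj hu h) hv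
  have hgP : ∀ i, (eP.symm i).1 ∈ B := fun i => hPB (eP.symm i).2
  have hgA : ∀ i, (eA.symm i).1 ∈ A := fun i => (mem_erase.1 (eA.symm i).2).2
  have hgB : ∀ i, (eB.symm i).1 ∈ B := fun i => (mem_sdiff.1 (eB.symm i).2).1
  have hwB : ∀ i, ¬ G.Adj w (eB.symm i).1 := fun i h =>
    (mem_sdiff.1 (eB.symm i).2).2 (hN _ h)
  have key : ∀ i j, G.Adj (g i) (g j) → (extremalGraph k m n).Adj i j := by
    rintro ((i | i) | (i | i)) ((j | j) | (j | j)) h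
    · exact (hAA _ hw _ hw h).elim
    · simp [extremalGraph, bipartiteNabla]
    · exact (hAA _ hw _ (hgA j) h).elim
    · exact (hwB j h).elim
    · simp [extremalGraph, bipartiteNabla]
    · exact (hBB _ (hgP i) _ (hgP j) h).elim
    · simp [extremalGraph, bipartiteNabla]
    · exact (hBB _ (hgP i) _ (hgB j) h).elim
    · exact (hAA _ (hgA i) _ hw h).elim
    · simp [extremalGraph, bipartiteNabla]
    · exact (hAA _ (hgA i) _ (hgA j) h).elim
    · simp [extremalGraph, bipartiteNabla]
    · exact (hwB i h.symm).elim
    · exact (hBB _ (hgB i) _ (hgP j) h).elim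
    · simp [extremalGraph, bipartiteNabla]
    · exact (hBB _ (hgB i) _ (hgB j) h).elim
  refine ⟨e.symm, fun u v h => key _ _ ?_⟩
  rwa [show g (e.symm u) = u from e.apply_symm_apply u,
    show g (e.symm v) = v from e.apply_symm_apply v]

/-- In a bipartite copy of the extremal graph, with unequal parts, some vertex of `A` has degree
less than `k`. -/
theorem exists_ncard_neighborSet_lt {k m n : ℕ} (hk : 2 ≤ k) (hm : 2 ≤ m) (hkn : k ≤ n)
    (hmn : m < n) {V : Type*} [Finite V] {G : SimpleGraph V} {A B : Set V}
    (hAB : G.IsBipartiteWith A B) (hV : A ∪ B = Set.univ) (hA : A.ncard = m)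
    (φ : G ≃g extremalGraph k m n) : ∃ v ∈ A, (G.neighborSet v).ncard < k := by
  have hadj : ∀ i j, (extremalGraph k m n).Adj i j → G.Adj (φ.symm i) (φ.symm j) :=
    fun i j h => φ.symm.map_adj_iff.2 h
  refine ⟨φ.symm (Sum.inl (Sum.inl 0)), ?_, ?_⟩
  -- If the isomorphism swapped the sides, `A` would contain all `n > m` vertices of the larger
  -- side.
  · by_contra hw
    have hwB : φ.symm (Sum.inl (Sum.inl 0)) ∈ B :=
      ((Set.ext_iff.1 hV _).2 trivial).resolve_left hw
    have hb : φ.symm (Sum.inl (Sum.inr ⟨0, by omega⟩)) ∈ A :=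
      hAB.symm.mem_of_mem_adj hwB (hadj _ _ (by simp [extremalGraph, bipartiteNabla]))
    have hc : φ.symm (Sum.inr (Sum.inl ⟨0, by omega⟩)) ∈ B :=
      hAB.mem_of_mem_adj hb (hadj _ _ (by simp [extremalGraph, bipartiteNabla]))
    let f : Fin (k - 1) ⊕ Fin (n - k + 1) → V :=
      fun i => φ.symm (Sum.elim (fun i => Sum.inl (Sum.inr i)) (fun i => Sum.inr (Sum.inr i)) i)
    have hf : Function.Injective f := by
      refine φ.symm.injective.comp ?_
      rintro (i | i) (j | j) h <;> simp_all
    have hfA : Set.range f ⊆ A := by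
      rintro _ ⟨i | i, rfl⟩
      · exact hAB.symm.mem_of_mem_adj hc (hadj _ _ (by simp [extremalGraph, bipartiteNabla]))
      · exact hAB.symm.mem_of_mem_adj hc (hadj _ _ (by simp [extremalGraph, bipartiteNabla]))
    have h1 := Set.ncard_le_ncard hfA (Set.toFinite _)
    rw [Set.ncard_range_of_injective hf, hA, Nat.card_eq_fintype_card] at h1
    simp only [Fintype.card_sum, Fintype.card_fin] at h1
    omega
  · have hsub : G.neighborSet (φ.symm (Sum.inl (Sum.inl 0))) ⊆
        Set.range fun i : Fin (k - 1) => φ.symm (Sum.inl (Sum.inr i)) := by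
      intro u hu
      obtain ⟨j, rfl⟩ := φ.symm.surjective u
      have := φ.symm.map_adj_iff.1 hu
      rcases j with (j | j) | (j | j)
      · simp [extremalGraph, bipartiteNabla] at this
      · exact ⟨j, rfl⟩
      · simp [extremalGraph, bipartiteNabla] at this
      · simp [extremalGraph, bipartiteNabla] at this
    refine (Set.ncard_le_ncard hsub (Set.toFinite _)).trans_lt ?_
    rw [← Set.image_univ]
    refine (Set.ncard_image_le (Set.toFinite _)).trans_lt ?_
    rw [Set.ncard_univ, Nat.card_eq_fintype_card, Fintype.card_fin]
    omega

/-! ### The main theorem. -/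

open Finset in
theorem theorem1p1 (k m n : ℕ) (hk : 3 ≤ k) (hm : 3 ≤ m) (hn : (k - 1) * m + 1 ≤ n)
    {V : Type*} [Fintype V] (G : SimpleGraph V) (hG : G.Connected)
    (A B : Set V) (hAB : G.IsBipartiteWith A B) (hV : A ∪ B = Set.univ)
    (hA : A.ncard = m) (hB : B.ncard = n)
    (hq : signlessRadius (extremalGraph k m n) ≤ signlessRadius G) :
    (∃ T : SimpleGraph V, T ≤ G ∧ T.IsTree ∧ ∀ v ∈ A, k ≤ (T.neighborSet v).ncard) ↔
      ¬ Nonempty (G ≃g extremalGraph k m n) := by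
  classical
  obtain ⟨l, rfl⟩ : ∃ l, k = l + 1 := ⟨k - 1, by omega⟩
  rw [Nat.add_sub_cancel] at hn
  have hkn : l + 1 ≤ n := by nlinarith
  have hmn : m < n := by nlinarith
  constructor
  · rintro ⟨T, hTG, -, hT⟩ ⟨φ⟩
    obtain ⟨v, hv, hlt⟩ := exists_ncard_neighborSet_lt (by omega) (by omega) hkn hmn hAB hV hA φ
    have := Set.ncard_le_ncard (show T.neighborSet v ⊆ G.neighborSet v from fun u hu => hTG hu)
      (Set.toFinite _)
    have := hT v hv
    omega
  intro hiso
  lift A to Finset V using Set.toFinite A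
  lift B to Finset V using Set.toFinite B
  rw [Set.ncard_coe_finset] at hA hB
  have hV' : ∀ v, v ∈ A ∨ v ∈ B := fun v => by
    simpa using (Set.ext_iff.1 hV v).2 trivial
  by_cases hall : ∀ s ⊆ A, s.Nonempty → l * #s + 1 ≤ #(s.biUnion fun v => G.neighborFinset v)
  · obtain ⟨T, hTG, hT, hd⟩ := exists_isTree_le_of_hall hG hAB (by omega) hall
    exact ⟨T, hTG, hT, hd⟩
  exfalso
  push Not at hall
  obtain ⟨S, hSA, hS, hlt⟩ := hall
  set N := S.biUnion fun v => G.neighborFinset v with hNdef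
  have hNB : N ⊆ B := by
    intro b hb
    obtain ⟨v, hv, hvb⟩ := mem_biUnion.1 hb
    exact hAB.mem_of_mem_adj (hSA hv) (by simpa using hvb)
  have hScard : #S ≤ m := hA ▸ card_le_card hSA
  have hSB : l * #S ≤ #B := by
    have := Nat.mul_le_mul_left l hScard
    omega
  -- Both comparisons need a set of exactly `l * #S` vertices, so `N` is padded inside `B`.
  obtain ⟨P, hNP, hPB, hP⟩ := exists_subsuperset_card_eq hNB (Nat.lt_succ_iff.1 hlt) hSB
  have hadjP : ∀ v ∈ S, ∀ u, G.Adj v u → u ∈ P := fun v hv u hu =>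
    hNP (mem_biUnion.2 ⟨v, hv, by simpa using hu⟩)
  have hSm : #S < m := by
    refine lt_of_le_of_ne hScard fun hSm => ?_
    have hSA' : S = A := eq_of_subset_of_card_le hSA (by omega)
    obtain ⟨w, hw⟩ := hS
    have hBP : B ⊆ P := by
      intro b hb
      have hbw : b ≠ w := fun h => Set.disjoint_left.1 hAB.disjoint (hSA hw) (h ▸ hb)
      obtain ⟨p⟩ := hG.preconnected b w
      cases p with
      | nil => exact absurd rfl hbw
      | cons h _ => exact hadjP _ (hSA' ▸ hAB.symm.mem_of_mem_adj hb h) _ h.symm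
    have := card_le_card hBP
    rw [hP, hSm, hB] at this
    omega
  have hlow := lt_signlessRadius_extremalGraph (k := l + 1) (m := m) (n := n) (by omega)
    (by omega) hkn
  rcases Nat.lt_or_ge 1 #S with hS2 | hS1
  · have := signlessRadius_le_of_neighbors_subset hAB hV' hSA hPB hadjP (k := l) (by omega) hS2
      (by omega) hP (by rw [hA, hB]; exact hn)
    rw [hA, hB] at this
    linarith
  · have hS1 : #S = 1 := le_antisymm hS1 hS.card_pos
    obtain ⟨w, rfl⟩ := card_eq_one.1 hS1
    obtain ⟨e, he⟩ := exists_equiv_extremalGraph (k := l + 1) hAB hV' (hSA (mem_singleton_self w))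
      hPB (hadjP w (mem_singleton_self w)) (by omega) hkn hA hB (by simpa using hP)
    exact hiso ⟨⟨e, fun {u v} => ⟨adj_of_signlessRadius_le hG e he hq, he u v⟩⟩⟩
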